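/- Corollary 1 (Lipschitz Fukuda–Fukuda). Let $f,g:(\mathbb R^n,0)\to(\mathbb R^p,0)$ be two $C^\infty$ map-germs which are Lipschitz stable. Suppose that there exist a germ of $C^\infty$ diffeomorphism $s:(\mathbb R^n,0)\to(\mathbb R^n,0)$ and a $C^\infty$ map-germ $M:(\mathbb R^n,0)\to (GL(p,\mathbb R),M(0))$ such that $f(x)=M(x)\,g(s(x))$ (that is, $f$ and $g$ are $\mathcal K$-equivalent). Then $f$ and $g$ are bi-Lipschitz $\mathcal A$-equivalent: there are germs of bi-Lipschitz homeomorphisms $\sigma:(\mathbb R^n,0)\to(\mathbb R^n,0)$ and $\tau:(\mathbb R^p,0)\to(\mathbb R^p,0)$ with $f=\tau\circ g\circ\sigma$. Here the following terms are used. A $C^\infty$ deformation-germ of $f$ is a $C^\infty$ map-germ $\Phi:(\mathbb R^n\times\mathbb R^k,(0,0))\to(\mathbb R^p,0)$, $k\ge 0$, with $\Phi(x,0)=f(x)$. The germ $f$ is Lipschitz stable if every $C^\infty$ deformation-germ of $f$ (for every $k$) is Lipschitz trivial. A deformation-germ $\Phi$ is Lipschitz trivial if there are $L$-stratifications $\mathcal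 S$ of $\mathbb R^n\times\mathbb R^k$, $\mathcal T$ of $\mathbb R^p\times\mathbb R^k$ and $\{\mathbb R^k\}$ of $\mathbb R^k$ such that, with $\pi,\pi'$ the canonical projections of $\mathbb R^n\times\mathbb R^k$ and of $\mathbb R^p\times\mathbb R^k$ to $\mathbb R^k$: (i) the germ at the origin of $(\Phi,\pi)$ is a stratified map with respect to $\mathcal S$ and $\mathcal T$ (near the origin it maps strata submersively into strata); (ii) the germ at the origin of $\pi'$ is a stratified map with respect to $\mathcal T$ and $\{\mathbb R^k\}$; (iii) for $1\le i\le k$ there are germs at the origin of Lipschitz vector fields $\xi_i+\partial/\partial\lambda_i$ on $\mathbb R^n\times\mathbb R^k$ tangent to the strata of $\mathcal S$, and $\eta_i+\partial/\partial\lambda_i$ on $\mathbb R^p\times\mathbb R^k$ tangent to the strata of $\mathcal T$, where $\xi_i$ has only $\mathbb R^n$-components and $\eta_i$ only $\mathbb R^p$-components, such that $d(\Phi,\pi)(\xi_i+\partial/\partial\lambda_i)=(\eta_i+\partial/\partial\lambda_i)\circ(\Phi,\pi)$ near the origin. A stratification of a Euclidean space $E$ of dimension $N$ is a filtration $\emptyset=X_{-1}\subseteq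 X_0\subseteq\dots\subseteq X_N=E$ by closed sets such that each $\mathring X_j=X_j\setminus X_{j-1}$ is empty or a $C^\infty$ submanifold of dimension $j$; its strata are the connected components of the $\mathring X_j$, and they form a locally finite family. For $q\in\mathring X_j$ let $P_q:E\to T_q\mathring X_j$ be the orthogonal projection, regarded as an endomorphism of $E$, and let $P_q^\perp=\mathrm{id}-P_q$. Let $X_l$ be the lowest nonempty skeleton. For $c>1$, a $c$-chain of $q\in\mathring X_{j_1}$ consists of indices $j_1>j_2>\dots>j_r=l$, where $j_{s+1}$ is the greatest $i<j_s$, $i\ge l$, with $\mathrm{dist}(q,X_m)\ge 2c^2\,\mathrm{dist}(q,X_i)$ for all $l\le m<i$, and of points $q_1=q$, $q_s\in\mathring X_{j_s}$ with $|q-q_s|\le c\,\mathrm{dist}(q,X_{j_s})$. The stratification is an $L$-stratification (in the sense of Mostowski) if there is a $c>1$ such that for every compact $K\subset E$ there is $C>0$ such that for all $c$-chains of points $q\in K$, with the convention $\mathrm{dist}(q,\emptyset)=1$ in the following bounds, $$|P_q^\perp P_{q_2}\cdots P_{q_k}|\le \frac{C\,|q-q_2|}{\mathrm{dist}(q,X_{j_k-1})}\quad(2\le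 k\le r),\qquad |(P_q-P_{q'})P_{q_2}\cdots P_{q_k}|\le \frac{C\,|q-q'|}{\mathrm{dist}(q,X_{j_k-1})}\quad(1\le k\le r)$$ for all $q'\in\mathring X_{j_1}$ with $|q-q'|\le\frac1{2c}\mathrm{dist}(q,X_{j_1-1})$ (for $k=1$ the product $P_{q_2}\cdots P_{q_k}$ is the identity). -/

import Mathlib

open Set Filter Topology
open scoped ContDiff NNReal

/-! ### Submanifolds, tangent spaces and stratifications of a Euclidean space -/

section Stratifications

variable {E : Type*} [NormedAddCommGroup E] [InnerProductSpace ℝ E] [FiniteDimensional ℝ E]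

/-- `A` is an embedded `C^∞` submanifold of `E` (without boundary, not necessarily closed), all of
whose points have local dimension `d`: near each of its points, a local `C^∞` diffeomorphism
of `E` straightens `A` to a linear subspace of dimension `d`. -/
def IsSmoothSubmanifold (A : Set E) (d : ℤ) : Prop :=
  ∀ x ∈ A, ∃ (φ : OpenPartialHomeomorph E E) (V : Submodule ℝ E),
    x ∈ φ.source ∧ ContDiffOn ℝ ∞ φ φ.source ∧ ContDiffOn ℝ ∞ φ.symm φ.target ∧
      (Module.finrank ℝ V : ℤ) = d ∧ φ '' (A ∩ φ.source) = (V : Set E) ∩ φ.target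

/-- The tangent space at `x` of a submanifold `A`: the velocities at time `0` of the curves that
run in `A` and pass through `x` at time `0`.  (For a submanifold these velocities
form a linear subspace already; the span only packages them as a `Submodule`.) -/
def tangentSpaceOf (A : Set E) (x : E) : Submodule ℝ E :=
  Submodule.span ℝ
    {v | ∃ γ : ℝ → E, γ 0 = x ∧ HasDerivAt γ v 0 ∧ ∀ᶠ t in 𝓝 (0 : ℝ), γ t ∈ A}

/-- A stratification of `E`: a filtration of `E` by closed sets
`∅ = X₋₁ ⊆ X₀ ⊆ ⋯ ⊆ X_N = E`, `N = dim E`, such that every difference `X_j \ X_{j-1}` is a `C^∞`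
submanifold of dimension `j` (or empty), and the family of the connected components of these
differences (the strata) is locally finite. -/
structure Stratification (E : Type*) [NormedAddCommGroup E] [InnerProductSpace ℝ E]
    [FiniteDimensional ℝ E] where
  /-- the skeleta of the stratification -/
  X : ℤ → Set E
  isClosed_X : ∀ j, IsClosed (X j)
  mono : Monotone X
  empty_of_neg : ∀ j < 0, X j = ∅
  top_eq_univ : X (Module.finrank ℝ E) = univ
  submanifold : ∀ j, IsSmoothSubmanifold (X j \ X (j - 1)) j
  locallyFinite : ∀ x : E, ∃ W ∈ 𝓝 x,
    {A : Set E | (∃ j, ∃ y ∈ X j \ X (j - 1), A = connectedComponentIn (X j \ X (j - 1)) y) ∧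
      (A ∩ W).Nonempty}.Finite

namespace Stratification

/-- The union of the strata of dimension `j`. -/
def layer (S : Stratification E) (j : ℤ) : Set E := S.X j \ S.X (j - 1)

/-- The stratum containing `z`: the connected component of `z` in the layer that contains `z`. -/
def stratum (S : Stratification E) (z : E) : Set E :=
  {w | ∃ j, z ∈ S.layer j ∧ w ∈ connectedComponentIn (S.layer j) z}

/-- The tangent space at `z` of the stratum containing `z`. -/
def tangent (S : Stratification E) (z : E) : Submodule ℝ E := tangentSpaceOf (S.stratum z) z

/-- The orthogonal projection `P_z` of `E` onto the tangent space at `z` of the stratum of `z`. -/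
noncomputable def P (S : Stratification E) (z : E) : E →L[ℝ] E := (S.tangent z).starProjection

/-- The distance from `q` to the skeleton `X_j`, with the convention `dist(q, ∅) = 1`. -/
noncomputable def distX (S : Stratification E) (q : E) (j : ℤ) : ℝ :=
  open Classical in if S.X j = ∅ then 1 else Metric.infDist q (S.X j)

/-- `dist(q, X_m) ≥ 2c² dist(q, X_i)` for all (nonempty) skeleta `X_m` with `m < i`. -/
def IsDrop (S : Stratification E) (c : ℝ) (q : E) (i : ℤ) : Prop :=
  (S.X i).Nonempty ∧ ∀ m < i, (S.X m).Nonempty →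
    2 * c ^ 2 * Metric.infDist q (S.X i) ≤ Metric.infDist q (S.X m)

/-- The indices `j 0 > j 1 > ⋯ > j r` and the points `q 0, …, q r` form a `c`-chain (of the point
`q 0`): `j 0` is the dimension of the stratum of `q 0`; each next index is the greatest integer
`i` below the previous one with `dist(q 0, X_m) ≥ 2c² dist(q 0, X_i)` for all nonempty `X_m`,
`m < i`; the last index is that of the lowest nonempty skeleton; and `q s` lies in the layer of
dimension `j s`, at distance at most `c · dist(q 0, X_{j s})` from `q 0`. -/
structure IsChain (S : Stratification E) (c : ℝ) (r : ℕ) (j : ℕ → ℤ) (q : ℕ → E) : Prop where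
  mem_layer : ∀ s ≤ r, q s ∈ S.layer (j s)
  next : ∀ s < r, IsGreatest {i | i < j s ∧ S.IsDrop c (q 0) i} (j (s + 1))
  last : S.X (j r - 1) = ∅
  near : ∀ s ≤ r, dist (q 0) (q s) ≤ c * Metric.infDist (q 0) (S.X (j s))

/-- The product `P_{q 1} P_{q 2} ⋯ P_{q k}` (the identity if `k = 0`). -/
noncomputable def chainProd (S : Stratification E) (q : ℕ → E) (k : ℕ) : E →L[ℝ] E :=
  ((List.range k).map fun s => S.P (q (s + 1))).prod

/-- `L`-stratifications (Lipschitz stratifications in the sense of Mostowski). With a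
fixed `c > 1`, the angle estimates hold for all `c`-chains, with a constant `C` that is
uniform on compact sets. -/
def IsLStratification (S : Stratification E) : Prop :=
  ∃ c : ℝ, 1 < c ∧ ∀ K : Set E, IsCompact K → ∃ C : ℝ, 0 < C ∧
    ∀ (r : ℕ) (j : ℕ → ℤ) (q : ℕ → E), S.IsChain c r j q → q 0 ∈ K →
      (∀ k, 1 ≤ k → k ≤ r →
        ‖(ContinuousLinearMap.id ℝ E - S.P (q 0)) * S.chainProd q k‖ ≤
          C * dist (q 0) (q 1) / S.distX (q 0) (j k - 1)) ∧
      (∀ k ≤ r, ∀ q' ∈ S.layer (j 0),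
        dist (q 0) q' ≤ 1 / (2 * c) * S.distX (q 0) (j 0 - 1) →
        ‖(S.P (q 0) - S.P q') * S.chainProd q k‖ ≤
          C * dist (q 0) q' / S.distX (q 0) (j k - 1))

/-- The stratification `{E}` of `E` with the single stratum `E`. -/
def single (E : Type*) [NormedAddCommGroup E] [InnerProductSpace ℝ E]
    [FiniteDimensional ℝ E] : Stratification E where
  X j := {_z | (Module.finrank ℝ E : ℤ) ≤ j}
  isClosed_X j := isClosed_const
  mono i j hij z hz := le_trans (show (Module.finrank ℝ E : ℤ) ≤ i from hz) hij
  empty_of_neg j hj := by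
    ext z
    simp only [mem_ofPred_eq, mem_empty_iff_false, iff_false, not_le]
    omega
  top_eq_univ := by simp
  submanifold j x hx := by
    have h1 : (Module.finrank ℝ E : ℤ) ≤ j := hx.1
    have h2 : ¬ (Module.finrank ℝ E : ℤ) ≤ j - 1 := hx.2
    refine ⟨OpenPartialHomeomorph.refl E, ⊤, by simp, ?_, ?_, ?_, ?_⟩
    · exact contDiffOn_id
    · exact contDiffOn_id
    · rw [finrank_top]; omega
    · ext z
      constructor
      · intro _
        exact ⟨trivial, trivial⟩
      · intro _
        exact ⟨z, ⟨⟨h1, h2⟩, trivial⟩, rfl⟩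
  locallyFinite x := by
    refine ⟨univ, univ_mem, (finite_singleton (univ : Set E)).subset ?_⟩
    rintro A ⟨⟨j, y, hy, rfl⟩, -⟩
    have h : ({_z : E | (Module.finrank ℝ E : ℤ) ≤ j} \
        {_z : E | (Module.finrank ℝ E : ℤ) ≤ j - 1}) = univ := by
      ext z
      simp only [mem_univ, iff_true]
      exact ⟨hy.1, hy.2⟩
    rw [h]
    exact isPreconnected_univ.connectedComponentIn (mem_univ y)

end Stratification

/-- The germ of `F` at `x₀` is a stratified map with respect to `S` and `T`: on some open
neighbourhood `U` of `x₀`, `F` maps each stratum of the restriction of `S` to `U` submersively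
into a stratum of `T`. -/
def IsStratifiedMapGerm {E' : Type*} [NormedAddCommGroup E'] [InnerProductSpace ℝ E']
    [FiniteDimensional ℝ E'] (S : Stratification E) (T : Stratification E') (F : E → E')
    (x₀ : E) : Prop :=
  ∃ U : Set E, IsOpen U ∧ x₀ ∈ U ∧ ∀ z ∈ U,
    MapsTo F (connectedComponentIn (S.stratum z ∩ U) z) (T.stratum (F z)) ∧
      DifferentiableAt ℝ F z ∧
      (S.tangent z).map (fderiv ℝ F z : E →ₗ[ℝ] E') = T.tangent (F z)

/-- The germ at `x₀` of the vector field `v` is stratified (tangent to the strata of `S`) and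
Lipschitz. -/
def IsStratifiedLipschitzFieldGerm (S : Stratification E) (v : E → E) (x₀ : E) : Prop :=
  ∃ U : Set E, IsOpen U ∧ x₀ ∈ U ∧ (∃ L : ℝ≥0, LipschitzOnWith L v U) ∧
    ∀ z ∈ U, v z ∈ S.tangent z

end Stratifications

/-! ### Map-germs -/

section Germs

/-- `ℝⁿ` with its Euclidean norm. -/
abbrev Euc (n : ℕ) : Type := EuclideanSpace ℝ (Fin n)

/-- `ℝⁿ × ℝᵏ` with its Euclidean norm. -/
abbrev EucProd (n k : ℕ) : Type := WithLp 2 (Euc n × Euc k)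

/-- The point `(x, l)` of `ℝⁿ × ℝᵏ`. -/
abbrev mkProd {n k : ℕ} (x : Euc n) (l : Euc k) : EucProd n k := WithLp.toLp 2 (x, l)

/-- `f` represents a `C^∞` map-germ at `x₀`: it is `C^∞` on an open neighbourhood of `x₀`. -/
def IsSmoothGerm {E F : Type*} [NormedAddCommGroup E] [NormedSpace ℝ E] [NormedAddCommGroup F]
    [NormedSpace ℝ F] (f : E → F) (x₀ : E) : Prop :=
  ∃ U : Set E, IsOpen U ∧ x₀ ∈ U ∧ ContDiffOn ℝ ∞ f U

/-- `s` represents a germ of `C^∞` diffeomorphism `(E, 0) → (E, 0)`. -/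
def IsSmoothDiffeoGerm {E : Type*} [NormedAddCommGroup E] [NormedSpace ℝ E] (s : E → E) : Prop :=
  s 0 = 0 ∧ ∃ φ : OpenPartialHomeomorph E E, (0 : E) ∈ φ.source ∧ EqOn s φ φ.source ∧
    ContDiffOn ℝ ∞ φ φ.source ∧ ContDiffOn ℝ ∞ φ.symm φ.target

/-- `s` represents a germ of bi-Lipschitz homeomorphism `(E, 0) → (E, 0)`. -/
def IsBiLipschitzGerm {E : Type*} [NormedAddCommGroup E] (s : E → E) : Prop :=
  s 0 = 0 ∧ ∃ φ : OpenPartialHomeomorph E E, (0 : E) ∈ φ.source ∧ EqOn s φ φ.source ∧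
    (∃ L : ℝ≥0, LipschitzOnWith L φ φ.source) ∧ ∃ L : ℝ≥0, LipschitzOnWith L φ.symm φ.target

/-- Bi-Lipschitz `𝒜`-equivalence of map-germs: `f = t ∘ g ∘ s` as germs at `0`, with germs of
bi-Lipschitz homeomorphisms `s` and `t`. -/
def BiLipschitzAEquivalent {n p : ℕ} (f g : Euc n → Euc p) : Prop :=
  ∃ (s : Euc n → Euc n) (t : Euc p → Euc p), IsBiLipschitzGerm s ∧ IsBiLipschitzGerm t ∧
    ∀ᶠ x in 𝓝 (0 : Euc n), f x = t (g (s x))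

/-- `Φ : (ℝⁿ × ℝᵏ, (0,0)) → (ℝᵖ, 0)` is a `C^∞` deformation-germ of `f`. -/
def IsDeformationGerm {n p k : ℕ} (f : Euc n → Euc p) (Φ : EucProd n k → Euc p) : Prop :=
  IsSmoothGerm Φ 0 ∧ Φ 0 = 0 ∧ ∀ᶠ x in 𝓝 (0 : Euc n), Φ (mkProd x 0) = f x

/-- The map `(Φ, π) : ℝⁿ × ℝᵏ → ℝᵖ × ℝᵏ`, where `π` is the canonical projection to `ℝᵏ`. -/
def withParam {n p k : ℕ} (Φ : EucProd n k → Euc p) : EucProd n k → EucProd p k :=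
  fun z => mkProd (Φ z) z.snd

/-- The vector field `ξ + ∂/∂λᵢ` on `ℝⁿ × ℝᵏ`, for a field `ξ` in the `ℝⁿ`-directions. -/
noncomputable def addPartial {n k : ℕ} (ξ : EucProd n k → Euc n) (i : Fin k) :
    EucProd n k → EucProd n k :=
  fun z => mkProd (ξ z) (EuclideanSpace.single i 1)

/-- The deformation-germ `Φ` is Lipschitz trivial. -/
def LipschitzTrivial {n p k : ℕ} (Φ : EucProd n k → Euc p) : Prop :=
  ∃ (S : Stratification (EucProd n k)) (T : Stratification (EucProd p k)),
    S.IsLStratification ∧ T.IsLStratification ∧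
    (Stratification.single (Euc k)).IsLStratification ∧
    IsStratifiedMapGerm S T (withParam Φ) 0 ∧
    IsStratifiedMapGerm T (Stratification.single (Euc k)) (fun w : EucProd p k => w.snd) 0 ∧
    ∃ (ξ : Fin k → EucProd n k → Euc n) (η : Fin k → EucProd p k → Euc p), ∀ i : Fin k,
      IsStratifiedLipschitzFieldGerm S (addPartial (ξ i) i) 0 ∧
      IsStratifiedLipschitzFieldGerm T (addPartial (η i) i) 0 ∧
      ∀ᶠ z in 𝓝 (0 : EucProd n k),
        fderiv ℝ (withParam Φ) z (addPartial (ξ i) i z) = addPartial (η i) i (withParam Φ z)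

/-- The map-germ `f` is Lipschitz stable: each of its `C^∞` deformation-germs, with any number of
parameters, is Lipschitz trivial. -/
def LipschitzStable {n p : ℕ} (f : Euc n → Euc p) : Prop :=
  ∀ (k : ℕ) (Φ : EucProd n k → Euc p), IsDeformationGerm f Φ → LipschitzTrivial Φ

end Germs

/-! Write `N = M⁻¹ ∘ s⁻¹`. The germs `Ψ(x, μ) = f(x) + M(x)μ - μ` and `Φ(x, λ) = g(x) + λ - N(x)λ`
are deformations of `f` and `g` with `p` parameters. With `b(x, μ) = (s(x), M(x)(μ + g(s(x))))` and
the shear `α(y, μ) = (y, μ + y)`, one computes `(Φ, π) ∘ b = α ∘ (Ψ, π)`. So the two unfoldings are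
smoothly equivalent, but by changes of coordinates that mix target and parameter: `α` does not carry
the slice `μ = 0`, over which `f` lives, to the slice `λ = 0`, over which `g` lives.

Lipschitz triviality repairs this. It provides Lipschitz fields upstairs that lift Lipschitz fields
downstairs, and sliding along these fields (`exists_holonomy`) identifies, by compatible
bi-Lipschitz germs in source and target, any two slices through the origin that are transverse to
the fields. The slice `λ = 0` is transverse to the fields of `Φ`, but its preimage `μ + y = 0` need
not be transverse to those of `Ψ`. A tilted slice `ρ = 0`, which `α` carries to `ρ' = 0`, is
therefore chosen so that both are transverse (`exists_isInvertible_add_smul`). Then `f` over `μ = 0`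
slides to `ρ = 0`, goes by `b` and `α` to `ρ' = 0`, and slides to `g` over `λ = 0`.

Flows of Lipschitz fields need not be differentiable, but they are strictly differentiable at the
origin, where the fields are nearly constant (`exists_localFlow`). This suffices for the implicit
function theorem to give a Lipschitz arrival time. -/

/-! ### Flows of Lipschitz families of vector fields -/

section Flows

variable {E F P : Type*} [NormedAddCommGroup E] [NormedSpace ℝ E]
  [NormedAddCommGroup F] [NormedSpace ℝ F] [NormedAddCommGroup P] [NormedSpace ℝ P]

/-- `z` is the endpoint at time `1` of an integral curve of the field `v · t` that starts at `y` and
runs in `W`. -/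
def FlowRel (v : E → P →L[ℝ] E) (W : Set E) (t : P) (y z : E) : Prop :=
  ∃ γ : ℝ → E, γ 0 = y ∧ γ 1 = z ∧ ∀ s ∈ Icc (0 : ℝ) 1,
    γ s ∈ W ∧ HasDerivWithinAt γ (v (γ s) t) (Icc 0 1) s

namespace FlowRel

variable {v : E → P →L[ℝ] E} {W W' : Set E} {t t' : P} {y y' z z' : E}

theorem mono (h : FlowRel v W t y z) (hW : W ⊆ W') : FlowRel v W' t y z := by
  obtain ⟨γ, h0, h1, hγ⟩ := h
  exact ⟨γ, h0, h1, fun s hs => ⟨hW (hγ s hs).1, (hγ s hs).2⟩⟩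

theorem symm (h : FlowRel v W t y z) : FlowRel v W (-t) z y := by
  obtain ⟨γ, h0, h1, hγ⟩ := h
  refine ⟨fun s => γ (1 - s), by simpa using h1, by simpa using h0, fun s hs => ?_⟩
  have hs' : 1 - s ∈ Icc (0 : ℝ) 1 := ⟨by linarith [hs.2], by linarith [hs.1]⟩
  refine ⟨(hγ _ hs').1, ?_⟩
  have hd : HasDerivWithinAt (fun s : ℝ => 1 - s) (-1) (Icc 0 1) s :=
    (hasDerivWithinAt_id s _).const_sub 1
  have := (hγ _ hs').2.scomp s hd fun u hu => ⟨by linarith [hu.2], by linarith [hu.1]⟩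
  simpa [Function.comp_def] using this

theorem image {w : F → P →L[ℝ] F} {G : E → F} {V : Set F} (h : FlowRel v W t y z)
    (hd : ∀ x ∈ W, DifferentiableAt ℝ G x) (hm : MapsTo G W V)
    (hG : ∀ x ∈ W, fderiv ℝ G x (v x t) = w (G x) t) : FlowRel w V t (G y) (G z) := by
  obtain ⟨γ, h0, h1, hγ⟩ := h
  refine ⟨G ∘ γ, by simp [h0], by simp [h1], fun s hs => ⟨hm (hγ s hs).1, ?_⟩⟩
  have := (hd _ (hγ s hs).1).hasFDerivAt.comp_hasDerivWithinAt s (hγ s hs).2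
  rwa [hG _ (hγ s hs).1] at this

/-- A quantitative form of strict differentiability of the flow: the left side is the error of the
linearization `(y, t) ↦ y + v 0 t`. The mean value inequality is applied twice, first to bound the
largest gap between the two curves, then to the gap minus its linear part. -/
theorem norm_sub_le {K : ℝ≥0} {B κ : ℝ} (hv : LipschitzOnWith K v W)
    (hB : ∀ x ∈ W, ‖v x‖ ≤ B) (hκ : ∀ x ∈ W, ‖v x - v 0‖ ≤ κ) (ht : K * ‖t‖ ≤ 1 / 2)
    (h : FlowRel v W t y z) (h' : FlowRel v W t' y' z') :
    ‖z - z' - (y - y') - v 0 (t - t')‖ ≤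
      2 * (K * ‖t‖) * (‖y - y'‖ + B * ‖t - t'‖) + κ * ‖t - t'‖ := by
  obtain ⟨γ, h0, h1, hγ⟩ := h
  obtain ⟨γ', h0', h1', hγ'⟩ := h'
  have hd : ∀ s ∈ Icc (0 : ℝ) 1, HasDerivWithinAt (fun s => γ s - γ' s)
      (v (γ s) t - v (γ' s) t') (Icc 0 1) s := fun s hs => (hγ s hs).2.sub (hγ' s hs).2
  have hc : ContinuousOn (fun s => ‖γ s - γ' s‖) (Icc 0 1) :=
    (HasDerivWithinAt.continuousOn hd).norm
  obtain ⟨s₀, hs₀, hmax⟩ := isCompact_Icc.exists_isMaxOn (nonempty_Icc.2 zero_le_one) hc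
  set m := ‖γ s₀ - γ' s₀‖ with hm
  have hm0 : 0 ≤ m := norm_nonneg _
  have hle : ∀ s ∈ Icc (0 : ℝ) 1, ‖(v (γ s) - v (γ' s)) t‖ ≤ K * ‖t‖ * m := fun s hs => by
    calc ‖(v (γ s) - v (γ' s)) t‖ ≤ ‖v (γ s) - v (γ' s)‖ * ‖t‖ :=
          ContinuousLinearMap.le_opNorm _ _
      _ ≤ (K * m) * ‖t‖ := by
          gcongr
          exact (hv.norm_sub_le (hγ s hs).1 (hγ' s hs).1).trans (by gcongr; exact hmax hs)
      _ = K * ‖t‖ * m := by ring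
  have hB0 : 0 ≤ B := (norm_nonneg _).trans (hB _ (hγ 0 (by simp)).1)
  -- The factor `2` comes from absorbing the term `K * ‖t‖ * m ≤ m / 2` into the left side, which
  -- replaces Grönwall's inequality.
  have hbound : m ≤ 2 * (‖y - y'‖ + B * ‖t - t'‖) := by
    have key := (convex_Icc (0 : ℝ) 1).norm_image_sub_le_of_norm_hasDerivWithin_le hd
      (C := K * ‖t‖ * m + B * ‖t - t'‖) (fun s hs => by
        have e : v (γ s) t - v (γ' s) t' = (v (γ s) - v (γ' s)) t + v (γ' s) (t - t') := by
          simp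
        rw [e]
        refine (norm_add_le _ _).trans (add_le_add (hle s hs) ?_)
        exact (ContinuousLinearMap.le_opNorm _ _).trans
          (by gcongr; exact hB _ (hγ' s hs).1)) (left_mem_Icc.2 zero_le_one) hs₀
    have hs1 : ‖s₀ - 0‖ ≤ 1 := by
      rw [sub_zero, Real.norm_eq_abs, abs_of_nonneg hs₀.1]; exact hs₀.2
    have hn : 0 ≤ K * ‖t‖ * m + B * ‖t - t'‖ := by positivity
    have h3 : m ≤ ‖y - y'‖ + ‖γ s₀ - γ' s₀ - (γ 0 - γ' 0)‖ := by
      rw [h0, h0', hm]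
      calc ‖γ s₀ - γ' s₀‖ = ‖(y - y') + (γ s₀ - γ' s₀ - (y - y'))‖ := by congr 1; abel
        _ ≤ _ := norm_add_le _ _
    have h4 := key.trans (mul_le_of_le_one_right hn hs1)
    have h5 : K * ‖t‖ * m ≤ 1 / 2 * m := by gcongr
    linarith
  have hd2 : ∀ s ∈ Icc (0 : ℝ) 1, HasDerivWithinAt (fun s => γ s - γ' s - s • v 0 (t - t'))
      (v (γ s) t - v (γ' s) t' - (1 : ℝ) • v 0 (t - t')) (Icc 0 1) s := fun s hs =>
    (hd s hs).sub ((hasDerivWithinAt_id s _).smul_const _)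
  have key := (convex_Icc (0 : ℝ) 1).norm_image_sub_le_of_norm_hasDerivWithin_le hd2
    (C := K * ‖t‖ * m + κ * ‖t - t'‖) (fun s hs => by
      have e : v (γ s) t - v (γ' s) t' - (1 : ℝ) • v 0 (t - t') =
          (v (γ s) - v (γ' s)) t + (v (γ' s) - v 0) (t - t') := by
        simp; abel
      rw [e]
      refine (norm_add_le _ _).trans (add_le_add (hle s hs) ?_)
      exact (ContinuousLinearMap.le_opNorm _ _).trans
        (by gcongr; exact hκ _ (hγ' s hs).1)) (left_mem_Icc.2 zero_le_one)
        (right_mem_Icc.2 zero_le_one)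
  simp only [h0, h0', h1, h1', one_smul, zero_smul, sub_zero, norm_one, mul_one] at key
  rw [sub_right_comm] at key
  refine key.trans (add_le_add_left ?_ _)
  calc K * ‖t‖ * m ≤ K * ‖t‖ * (2 * (‖y - y'‖ + B * ‖t - t'‖)) := by gcongr
    _ = _ := by ring

theorem unique {K : ℝ≥0} {B : ℝ} (hv : LipschitzOnWith K v W)
    (hB : ∀ x ∈ W, ‖v x‖ ≤ B) (ht : K * ‖t‖ ≤ 1 / 2)
    (h : FlowRel v W t y z) (h' : FlowRel v W t y z') : z = z' := by
  -- Any admissible `κ` would do, since it is multiplied by `‖t - t‖ = 0`.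
  have := norm_sub_le hv hB (κ := B + ‖v 0‖)
    (fun x hx => (_root_.norm_sub_le _ _).trans (by gcongr; exact hB x hx)) ht h h'
  simp only [sub_self, map_zero, norm_zero, sub_zero, mul_zero, add_zero, norm_le_zero_iff] at this
  exact sub_eq_zero.1 this

/-- A curve of speed at most `B * ‖t‖` that starts at `y` cannot leave the ball of radius `a` within
unit time. The fixed point of the Picard operator is used directly, because it comes with the
confinement to the ball. -/
theorem exists_of_le [CompleteSpace E] {K : ℝ≥0} {B a : ℝ}
    (hv : LipschitzOnWith K v (Metric.closedBall 0 a))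
    (hB : ∀ x ∈ Metric.closedBall (0 : E) a, ‖v x‖ ≤ B) (hB0 : 0 ≤ B)
    (ha : ‖y‖ + B * ‖t‖ ≤ a) : ∃ z, FlowRel v (Metric.closedBall 0 a) t y z := by
  have ha0 : 0 ≤ a := le_trans (by positivity) ha
  lift a to ℝ≥0 using ha0
  lift B to ℝ≥0 using hB0
  have hP : IsPicardLindelof (fun _ x => v x t) (tmin := 0) (tmax := 1)
      ⟨0, left_mem_Icc.2 zero_le_one⟩ (0 : E) a ‖y‖₊ (B * ‖t‖₊) (K * ‖t‖₊) := by
    apply IsPicardLindelof.of_time_independent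
    · intro x hx
      refine ((v x).le_opNorm t).trans ?_
      push_cast
      gcongr
      exact hB x hx
    · refine LipschitzOnWith.of_dist_le_mul fun x hx x' hx' => ?_
      rw [dist_eq_norm, dist_eq_norm, ← sub_apply]
      refine (ContinuousLinearMap.le_opNorm _ t).trans ?_
      push_cast
      calc _ ≤ (K * ‖x - x'‖) * ‖t‖ := by gcongr; exact hv.norm_sub_le hx hx'
        _ = _ := by ring
    · simp; linarith
  have hy : y ∈ Metric.closedBall (0 : E) (‖y‖₊ : ℝ) := by simp
  obtain ⟨α, hα⟩ := ODE.FunSpace.exists_isFixedPt_next hP hy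
  refine ⟨_, α.compProj, ?_, rfl, fun s hs => ⟨α.compProj_mem_closedBall hP.mul_max_le, ?_⟩⟩
  · have := ODE.FunSpace.next_apply₀ hP hy α
    rw [hα] at this
    rwa [← ODE.FunSpace.compProj_val] at this
  · apply ODE.hasDerivWithinAt_picard_Icc (left_mem_Icc.2 zero_le_one) hP.continuousOn_uncurry
      α.continuous_compProj.continuousOn (fun _ _ ↦ α.compProj_mem_closedBall hP.mul_max_le)
      y hs |>.congr_of_mem _ hs
    intro s' hs'
    nth_rw 1 [← hα]
    rw [ODE.FunSpace.compProj_of_mem hs', ODE.FunSpace.next_apply]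

end FlowRel

/-- The time `1` map of the fields `v · t`, as a function of the initial point and of `t`, with its
strict derivative at the origin. -/
theorem exists_localFlow [CompleteSpace E] {v : E → P →L[ℝ] E} {K : ℝ≥0} {U : Set E}
    (hU : U ∈ 𝓝 0) (hv : LipschitzOnWith K v U) :
    ∃ φ : E × P → E, φ 0 = 0 ∧ (∀ W ∈ 𝓝 (0 : E), ∀ᶠ u in 𝓝 (0 : E × P),
        FlowRel v W u.2 u.1 (φ u)) ∧
      HasStrictFDerivAt φ (ContinuousLinearMap.fst ℝ E P + v 0 ∘L ContinuousLinearMap.snd ℝ E P)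
        0 := by
  obtain ⟨a, ha, haU⟩ := Metric.nhds_basis_closedBall.mem_iff.1 hU
  have hva := hv.mono haU
  have h0a : (0 : E) ∈ Metric.closedBall (0 : E) a := by simp [ha.le]
  have hκ : ∀ x ∈ Metric.closedBall (0 : E) a, ‖v x - v 0‖ ≤ K * ‖x‖ := fun x hx => by
    simpa using hva.norm_sub_le hx h0a
  set B := ‖v 0‖ + K * a with hBdef
  have hB0 : 0 ≤ B := by positivity
  have hB : ∀ x ∈ Metric.closedBall (0 : E) a, ‖v x‖ ≤ B := fun x hx => by
    calc ‖v x‖ = ‖v 0 + (v x - v 0)‖ := by congr 1; abel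
      _ ≤ ‖v 0‖ + K * ‖x‖ := (norm_add_le _ _).trans (by gcongr; exact hκ x hx)
      _ ≤ B := by rw [hBdef]; gcongr; simpa using hx
  -- The radius is the smallest that the existence result allows. It shrinks to `0` with `u`, so a
  -- single choice of `φ` stays in every prescribed neighbourhood and vanishes at the origin.
  have hex : ∀ u : E × P, ‖u.1‖ + B * ‖u.2‖ ≤ a →
      ∃ z, FlowRel v (Metric.closedBall 0 (‖u.1‖ + B * ‖u.2‖)) u.2 u.1 z := fun u hu =>
    have hsub := Metric.closedBall_subset_closedBall (x := (0 : E)) hu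
    FlowRel.exists_of_le (hva.mono hsub) (fun x hx => hB x (hsub hx)) hB0 le_rfl
  choose! φ hφ using hex
  have htend : Tendsto (fun u : E × P => ‖u.1‖ + B * ‖u.2‖) (𝓝 0) (𝓝 0) := by
    have : Continuous fun u : E × P => ‖u.1‖ + B * ‖u.2‖ := by fun_prop
    simpa using this.tendsto 0
  have hflow : ∀ r, 0 < r → r ≤ a → ∀ᶠ u in 𝓝 (0 : E × P),
      FlowRel v (Metric.closedBall 0 r) u.2 u.1 (φ u) := fun r hr hra => by
    filter_upwards [htend.eventually_lt_const hr] with u hu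
    exact (hφ u (hu.le.trans hra)).mono (Metric.closedBall_subset_closedBall hu.le)
  refine ⟨φ, ?_, ?_, ?_⟩
  · obtain ⟨γ, -, h1, hγ⟩ := hφ 0 (by simpa using ha.le)
    have := (hγ 1 (by simp)).1
    rw [h1] at this
    simpa using this
  · intro W hW
    obtain ⟨b, hb, hbW⟩ := Metric.nhds_basis_closedBall.mem_iff.1 hW
    filter_upwards [hflow (min a b) (lt_min ha hb) (min_le_left _ _)] with u hu
    exact hu.mono ((Metric.closedBall_subset_closedBall (min_le_right _ _)).trans hbW)
  · refine HasStrictFDerivAt.of_isLittleO (Asymptotics.isLittleO_iff.2 fun c hc => ?_)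
    -- Half of `c` pays for the variation of `v` on the ball of radius `r`; the other half pays for
    -- the Lipschitz term, through `K * ‖t‖ ≤ c / (4 * (1 + B))`.
    set r := min a (c / (2 * (K + 1))) with hr
    have hr0 : 0 < r := lt_min ha (by positivity)
    have hKr : K * r ≤ c / 2 := by
      calc K * r ≤ (K + 1) * (c / (2 * (K + 1))) := by
            gcongr
            · linarith
            · exact min_le_right _ _
        _ = c / 2 := by field_simp
    have hsub : Metric.closedBall (0 : E) r ⊆ Metric.closedBall 0 a :=
      Metric.closedBall_subset_closedBall (min_le_left _ _)
    have hsmall : ∀ d > 0, ∀ᶠ u : E × P in 𝓝 0, K * ‖u.2‖ ≤ d := fun d hd => by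
      have : Tendsto (fun u : E × P => K * ‖u.2‖) (𝓝 0) (𝓝 0) := by
        have h : Continuous fun u : E × P => K * ‖u.2‖ := by fun_prop
        simpa using h.tendsto 0
      exact (this.eventually_lt_const hd).mono fun u hu => hu.le
    have hev := ((hflow r hr0 (min_le_left _ _)).and ((hsmall (1 / 2) (by norm_num)).and
      (hsmall (c / (4 * (1 + B))) (by positivity)))).prod_nhds (hflow r hr0 (min_le_left _ _))
    filter_upwards [hev] with u hu
    obtain ⟨⟨h1, h2, h3⟩, h4⟩ := hu
    have key := FlowRel.norm_sub_le (κ := c / 2) (hva.mono hsub) (fun x hx => hB x (hsub hx))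
      (fun x hx => (hκ x (hsub hx)).trans ((by gcongr; simpa using hx : K * ‖x‖ ≤ K * r).trans hKr))
      h2 h1 h4
    have e : φ u.1 - φ u.2 - (ContinuousLinearMap.fst ℝ E P + v 0 ∘L ContinuousLinearMap.snd ℝ E P)
        (u.1 - u.2) = φ u.1 - φ u.2 - (u.1.1 - u.2.1) - v 0 (u.1.2 - u.2.2) := by
      simp; abel
    rw [e]
    refine key.trans ?_
    have n1 : ‖u.1.1 - u.2.1‖ ≤ ‖u.1 - u.2‖ := norm_fst_le (u.1 - u.2)
    have n2 : ‖u.1.2 - u.2.2‖ ≤ ‖u.1 - u.2‖ := norm_snd_le (u.1 - u.2)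
    calc _ ≤ 2 * (c / (4 * (1 + B))) * (‖u.1 - u.2‖ + B * ‖u.1 - u.2‖) + c / 2 * ‖u.1 - u.2‖ := by
          gcongr
      _ = c * ‖u.1 - u.2‖ := by field_simp; ring

theorem exists_flowRel_unique {v : E → P →L[ℝ] E} {K : ℝ≥0} {U : Set E}
    (hU : U ∈ 𝓝 0) (hv : LipschitzOnWith K v U) :
    ∃ W ∈ 𝓝 (0 : E), ∀ᶠ t in 𝓝 (0 : P), ∀ y z z', FlowRel v W t y z → FlowRel v W t y z' →
      z = z' := by
  have hc : ContinuousAt v 0 := hv.continuousOn.continuousAt hU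
  refine ⟨U ∩ {x | ‖v x‖ ≤ ‖v 0‖ + 1}, inter_mem hU
    ((hc.norm.eventually_lt_const (lt_add_one _)).mono fun x hx => hx.le), ?_⟩
  have : Tendsto (fun t : P => K * ‖t‖) (𝓝 0) (𝓝 0) := by
    have h : Continuous fun u : P => K * ‖u‖ := by fun_prop
    simpa using h.tendsto 0
  filter_upwards [this.eventually_lt_const (by norm_num : (0 : ℝ) < 1 / 2)] with t ht y z z' h h'
  exact FlowRel.unique (hv.mono inter_subset_left) (fun x hx => hx.2) ht.le h h'

end Flows

/-! ### Germs of Lipschitz maps -/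

section LipschitzGerms

variable {E F H : Type*} [NormedAddCommGroup E] [NormedAddCommGroup F] [NormedAddCommGroup H]

/-- `f` represents a germ of Lipschitz map `(E, 0) → (F, 0)`. -/
def IsLipschitzGerm (f : E → F) : Prop :=
  f 0 = 0 ∧ ∃ K : ℝ≥0, ∃ U ∈ 𝓝 (0 : E), LipschitzOnWith K f U

namespace IsLipschitzGerm

theorem continuousAt {f : E → F} (hf : IsLipschitzGerm f) : ContinuousAt f 0 := by
  obtain ⟨-, K, U, hU, h⟩ := hf
  exact h.continuousOn.continuousAt hU

theorem tendsto {f : E → F} (hf : IsLipschitzGerm f) : Tendsto f (𝓝 0) (𝓝 0) := by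
  simpa [hf.1] using hf.continuousAt.tendsto

theorem comp {g : F → H} {f : E → F} (hg : IsLipschitzGerm g) (hf : IsLipschitzGerm f) :
    IsLipschitzGerm fun x => g (f x) := by
  have ht := hf.tendsto
  obtain ⟨h0, K, U, hU, h⟩ := hf
  obtain ⟨h0', K', U', hU', h'⟩ := hg
  exact ⟨by simp [h0, h0'], K' * K, U ∩ f ⁻¹' U', inter_mem hU (ht hU'),
    h'.comp (h.mono inter_subset_left) fun x hx => hx.2⟩

theorem prodMk {f : E → F} {g : E → H} (hf : IsLipschitzGerm f) (hg : IsLipschitzGerm g) :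
    IsLipschitzGerm fun x => (f x, g x) := by
  obtain ⟨h0, K, U, hU, h⟩ := hf
  obtain ⟨h0', K', U', hU', h'⟩ := hg
  exact ⟨by simp [h0, h0'], max K K', U ∩ U', inter_mem hU hU',
    (h.mono inter_subset_left).prodMk (h'.mono inter_subset_right)⟩

theorem id : IsLipschitzGerm fun x : E => x :=
  ⟨rfl, 1, univ, univ_mem, LipschitzWith.id.lipschitzOnWith⟩

/-- Two mutually inverse Lipschitz germs form a germ of bi-Lipschitz homeomorphism. -/
theorem isBiLipschitzGerm {f g : E → E} (hf : IsLipschitzGerm f) (hg : IsLipschitzGerm g)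
    (hgf : ∀ᶠ x in 𝓝 0, g (f x) = x) (hfg : ∀ᶠ x in 𝓝 0, f (g x) = x) : IsBiLipschitzGerm f := by
  obtain ⟨h0, K, U, hU, h⟩ := hf
  obtain ⟨h0', K', U', hU', h'⟩ := hg
  obtain ⟨V, hVU, hV, hV0⟩ := mem_nhds_iff.1 (inter_mem hU hgf)
  obtain ⟨V', hVU', hV', hV0'⟩ := mem_nhds_iff.1 (inter_mem hU' hfg)
  have hc : ContinuousOn f V := h.continuousOn.mono fun x hx => (hVU hx).1
  have hc' : ContinuousOn g V' := h'.continuousOn.mono fun x hx => (hVU' hx).1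
  refine ⟨h0,
    { toFun := f
      invFun := g
      -- Both sets are cut down so that `f` and `g` exchange them exactly; continuity on `V` and
      -- `V'` keeps them open.
      source := V ∩ f ⁻¹' V'
      target := V' ∩ g ⁻¹' V
      map_source' := fun x hx => ⟨hx.2, by
        have : g (f x) = x := (hVU hx.1).2
        simpa [this] using hx.1⟩
      map_target' := fun x hx => ⟨hx.2, by
        have : f (g x) = x := (hVU' hx.1).2
        simpa [this] using hx.1⟩
      left_inv' := fun x hx => (hVU hx.1).2
      right_inv' := fun x hx => (hVU' hx.1).2
      open_source := hc.isOpen_inter_preimage hV hV'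
      open_target := hc'.isOpen_inter_preimage hV' hV
      continuousOn_toFun := hc.mono inter_subset_left
      continuousOn_invFun := hc'.mono inter_subset_left },
    ⟨hV0, by simpa [h0] using hV0'⟩, fun x _ => rfl,
    ⟨K, h.mono fun x hx => (hVU hx.1).1⟩, ⟨K', h'.mono fun x hx => (hVU' hx.1).1⟩⟩

end IsLipschitzGerm

theorem HasStrictFDerivAt.isLipschitzGerm [NormedSpace ℝ E] [NormedSpace ℝ F] {f : E → F}
    {f' : E →L[ℝ] F} (hf : HasStrictFDerivAt f f' 0) (h0 : f 0 = 0) : IsLipschitzGerm f :=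
  ⟨h0, hf.exists_lipschitzOnWith⟩

theorem ContDiffAt.isLipschitzGerm [NormedSpace ℝ E] [NormedSpace ℝ F] {f : E → F}
    (hf : ContDiffAt ℝ ∞ f 0) (h0 : f 0 = 0) : IsLipschitzGerm f :=
  (hf.hasStrictFDerivAt (by simp)).isLipschitzGerm h0

end LipschitzGerms

/-! ### Sliding between transverse slices -/

section Holonomy

variable {E F P : Type*} [NormedAddCommGroup E] [NormedSpace ℝ E] [CompleteSpace E]
  [NormedAddCommGroup F] [NormedSpace ℝ F] [CompleteSpace F]
  [NormedAddCommGroup P] [NormedSpace ℝ P] [CompleteSpace P]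

/-- The holonomies along the leaves of a family of liftable Lipschitz fields: they carry any slice
to the slice `ρ = 0`, when `ρ` is transverse to the fields at the origin. -/
theorem exists_holonomy {v : E → P →L[ℝ] E} {w : F → P →L[ℝ] F} {K L : ℝ≥0} {U : Set E}
    {V : Set F} (hU : U ∈ 𝓝 0) (hv : LipschitzOnWith K v U) (hV : V ∈ 𝓝 0)
    (hw : LipschitzOnWith L w V) {G : E → F} (hGl : IsLipschitzGerm G)
    (hGd : ∀ᶠ x in 𝓝 0, DifferentiableAt ℝ G x)
    (hG : ∀ᶠ x in 𝓝 0, ∀ t, fderiv ℝ G x (v x t) = w (G x) t) :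
    ∃ (h : (F →L[ℝ] P) → F → F) (H : (F →L[ℝ] P) → E → E), ∀ ρ : F →L[ℝ] P,
      (ρ ∘L w 0).IsInvertible →
        IsLipschitzGerm (h ρ) ∧ IsLipschitzGerm (H ρ) ∧
        (∀ᶠ y in 𝓝 0, ρ (h ρ y) = 0) ∧ (∀ᶠ x in 𝓝 0, G (H ρ x) = h ρ (G x)) ∧
        ∀ ρ' : F →L[ℝ] P, (ρ' ∘L w 0).IsInvertible →
          (∀ᶠ y in 𝓝 0, ρ' y = 0 → h ρ' (h ρ y) = y) ∧
          ∀ᶠ x in 𝓝 0, ρ' (G x) = 0 → H ρ' (H ρ x) = x := by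
  obtain ⟨φ, hφ0, hφ, hφd⟩ := exists_localFlow hU hv
  obtain ⟨ψ, hψ0, hψ, hψd⟩ := exists_localFlow hV hw
  obtain ⟨W, hW, hWu⟩ := exists_flowRel_unique hU hv
  obtain ⟨W', hW', hWu'⟩ := exists_flowRel_unique hV hw
  have hφl := hφd.isLipschitzGerm hφ0
  have hψl := hψd.isLipschitzGerm hψ0
  have sndE : Tendsto (fun u : E × P => u.2) (𝓝 0) (𝓝 0) := continuous_snd.tendsto 0
  have sndF : Tendsto (fun u : F × P => u.2) (𝓝 0) (𝓝 0) := continuous_snd.tendsto 0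
  have negE : Tendsto (fun u : E × P => -u.2) (𝓝 0) (𝓝 0) := by simpa using sndE.neg
  have negF : Tendsto (fun u : F × P => -u.2) (𝓝 0) (𝓝 0) := by simpa using sndF.neg
  -- Going back uses the same curve in reverse, so the fields for different `t` need not commute.
  have revE : ∀ᶠ u in 𝓝 (0 : E × P), φ (φ u, -u.2) = u.1 := by
    filter_upwards [hφ W hW, (hφl.tendsto.prodMk_nhds negE).eventually (hφ W hW),
      negE.eventually hWu] with u h1 h2 h3
    exact h3 _ _ _ h2 h1.symm
  have revF : ∀ᶠ u in 𝓝 (0 : F × P), ψ (ψ u, -u.2) = u.1 := by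
    filter_upwards [hψ W' hW', (hψl.tendsto.prodMk_nhds negF).eventually (hψ W' hW'),
      negF.eventually hWu'] with u h1 h2 h3
    exact h3 _ _ _ h2 h1.symm
  have fstE : Tendsto (fun u : E × P => G u.1) (𝓝 0) (𝓝 0) :=
    hGl.tendsto.comp (continuous_fst.tendsto 0)
  have lift : ∀ᶠ u in 𝓝 (0 : E × P), G (φ u) = ψ (G u.1, u.2) := by
    have hS := hGd.and (hG.and (hGl.tendsto hW'))
    filter_upwards [hφ _ hS, (fstE.prodMk_nhds sndE).eventually (hψ W' hW'),
      sndE.eventually hWu'] with u h1 h2 h3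
    exact h3 _ _ _ (h1.image (fun x hx => hx.1) (fun x hx => hx.2.2) fun x hx => hx.2.1 _) h2
  -- The partial derivative of `ρ (ψ (y, t))` in `t` at the origin is `ρ ∘ w 0`, so the equation for
  -- the arrival parameter `t = T ρ y` is solved by the implicit function theorem for strict
  -- derivatives.
  have htime : ∀ ρ : F →L[ℝ] P, (ρ ∘L w 0).IsInvertible → ∃ T : F → P, IsLipschitzGerm T ∧
      ∀ᶠ u in 𝓝 (0 : F × P), ρ (ψ u) = 0 ↔ T u.1 = u.2 := by
    intro ρ hρ
    have hd := ρ.hasStrictFDerivAt.comp (0 : F × P) hψd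
    have hi : ((ρ ∘L (ContinuousLinearMap.fst ℝ F P + w 0 ∘L ContinuousLinearMap.snd ℝ F P)) ∘L
        ContinuousLinearMap.inr ℝ F P).IsInvertible := by
      convert hρ using 1
      ext; simp
    have hiff := hd.eventually_apply_eq_iff_implicitFunctionOfProdDomain hi
    simp only [hψ0, map_zero] at hiff
    exact ⟨_, (hd.hasStrictFDerivAt_implicitFunctionOfProdDomain hi).isLipschitzGerm
      (hiff.self_of_nhds.1 (by simp [hψ0])), hiff⟩
  choose! T hTl hT using htime
  -- Upstairs the arrival parameter is that of the image point, which makes `G` intertwine the two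
  -- slides.
  refine ⟨fun ρ y => ψ (y, T ρ y), fun ρ x => φ (x, T ρ (G x)), fun ρ hρ => ?_⟩
  have hp : IsLipschitzGerm fun y => (y, T ρ y) := IsLipschitzGerm.id.prodMk (hTl ρ hρ)
  have hq : IsLipschitzGerm fun x => (x, T ρ (G x)) :=
    IsLipschitzGerm.id.prodMk ((hTl ρ hρ).comp hGl)
  have hGH : ∀ᶠ x in 𝓝 0, G (φ (x, T ρ (G x))) = ψ (G x, T ρ (G x)) := hq.tendsto.eventually lift
  refine ⟨hψl.comp hp, hφl.comp hq, ?_, hGH, fun ρ' hρ' => ?_⟩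
  · filter_upwards [hp.tendsto.eventually (hT ρ hρ)] with y hy
    exact hy.2 rfl
  -- The parameter `-T ρ y` brings the point back to `y`, which lies on `ρ' = 0`; local uniqueness
  -- of the arrival parameter identifies it.
  have htr : ∀ᶠ y in 𝓝 0, ρ' y = 0 → T ρ' (ψ (y, T ρ y)) = -T ρ y := by
    have ht : Tendsto (fun y => (ψ (y, T ρ y), -T ρ y)) (𝓝 0) (𝓝 0) :=
      (hψl.comp hp).tendsto.prodMk_nhds (by simpa using (hTl ρ hρ).tendsto.neg)
    filter_upwards [ht.eventually (hT ρ' hρ'), hp.tendsto.eventually revF] with y h1 h2 h3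
    exact h1.1 (by rw [h2, h3])
  constructor
  · filter_upwards [htr, hp.tendsto.eventually revF] with y h1 h2 h3
    rw [h1 h3, h2]
  · filter_upwards [hGl.tendsto.eventually htr, hq.tendsto.eventually revE, hGH] with x h1 h2 h3 h4
    rw [h3, h1 h4, h2]

end Holonomy

/-! ### A slice transverse to both families -/

/-- The first map is invertible for all small `c`, the second unless `-c` is one of the finitely
many eigenvalues of `B`; so every small enough `c ≠ 0` works. -/
theorem exists_isInvertible_add_smul {P : Type*} [NormedAddCommGroup P] [NormedSpace ℝ P]
    [FiniteDimensional ℝ P] (A B : P →L[ℝ] P) :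
    ∃ c : ℝ, (ContinuousLinearMap.id ℝ P + c • A).IsInvertible ∧
      (B + c • ContinuousLinearMap.id ℝ P).IsInvertible := by
  have : CompleteSpace P := FiniteDimensional.complete ℝ P
  have h1 : ∀ᶠ c in 𝓝 (0 : ℝ), IsUnit (1 + c • A) := by
    have ht : Tendsto (fun c : ℝ => 1 + c • A) (𝓝 0) (𝓝 1) := by
      have : Continuous fun c : ℝ => 1 + c • A := by fun_prop
      simpa using this.tendsto 0
    exact ht.eventually (Units.isOpen.mem_nhds isUnit_one)
  have h2 : ∀ᶠ c in 𝓝[≠] (0 : ℝ), -c ∉ spectrum ℝ (B : Module.End ℝ P) := by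
    have hf : ((fun c : ℝ => -c) ⁻¹' spectrum ℝ (B : Module.End ℝ P)).Finite :=
      (Module.End.finite_spectrum _).preimage neg_injective.injOn
    have ho := (hf.sdiff (t := {0})).isClosed.isOpen_compl.mem_nhds
      (show (0 : ℝ) ∈ _ from fun h => h.2 rfl)
    filter_upwards [nhdsWithin_le_nhds ho, self_mem_nhdsWithin] with c h hc hs
    exact h ⟨hs, hc⟩
  obtain ⟨c, hc1, hc2⟩ := ((h1.filter_mono nhdsWithin_le_nhds).and h2).exists
  have key : ∀ C : P →L[ℝ] P, Function.Bijective C → C.IsInvertible := fun C hC =>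
    ⟨ContinuousLinearEquiv.ofBijective C (LinearMap.ker_eq_bot.2 hC.1) (LinearMap.range_eq_top.2 hC.2),
      rfl⟩
  refine ⟨c, key _ (ContinuousLinearMap.isUnit_iff_bijective.1 hc1), key _ ?_⟩
  rw [spectrum.notMem_iff, Module.End.isUnit_iff] at hc2
  convert (Equiv.neg P).bijective.comp hc2 using 1
  ext x
  simp [Module.algebraMap_end_apply]

/-! ### Product coordinates, and fields from Lipschitz triviality -/

section

theorem isSmoothGerm_iff_eventually_contDiffAt {E F : Type*} [NormedAddCommGroup E]
    [NormedSpace ℝ E] [NormedAddCommGroup F] [NormedSpace ℝ F] {f : E → F} {x₀ : E} :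
    IsSmoothGerm f x₀ ↔ ∀ᶠ x in 𝓝 x₀, ContDiffAt ℝ ∞ f x := by
  constructor
  · rintro ⟨U, hU, hx, hf⟩
    filter_upwards [hU.mem_nhds hx] with x hx
    exact hf.contDiffAt (hU.mem_nhds hx)
  · intro h
    obtain ⟨U, hU, hUo, hx⟩ := mem_nhds_iff.1 h
    exact ⟨U, hUo, hx, fun x hx => ContDiffAt.contDiffWithinAt (hU hx)⟩

theorem ContinuousLinearMap.isLipschitzGerm {E F : Type*} [NormedAddCommGroup E]
    [NormedSpace ℝ E] [NormedAddCommGroup F] [NormedSpace ℝ F] (A : E →L[ℝ] F) :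
    IsLipschitzGerm A :=
  A.hasStrictFDerivAt.isLipschitzGerm (map_zero A)

variable {n p k : ℕ}

theorem IsLipschitzGerm.mkProd {E : Type*} [NormedAddCommGroup E] {f : E → Euc n} {g : E → Euc k}
    (hf : IsLipschitzGerm f) (hg : IsLipschitzGerm g) :
    IsLipschitzGerm fun x => mkProd (f x) (g x) :=
  (ContinuousLinearMap.isLipschitzGerm
    ((WithLp.prodContinuousLinearEquiv 2 ℝ (Euc n) (Euc k)).symm :
      Euc n × Euc k →L[ℝ] EucProd n k)).comp (hf.prodMk hg)

theorem IsLipschitzGerm.fst {E : Type*} [NormedAddCommGroup E] {f : E → EucProd n k}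
    (hf : IsLipschitzGerm f) : IsLipschitzGerm fun x => (f x).fst :=
  (WithLp.fstL 2 ℝ (Euc n) (Euc k)).isLipschitzGerm.comp hf

theorem ContDiffAt.mkProd {E : Type*} [NormedAddCommGroup E] [NormedSpace ℝ E] {f : E → Euc n}
    {g : E → Euc k} {x : E} (hf : ContDiffAt ℝ ∞ f x) (hg : ContDiffAt ℝ ∞ g x) :
    ContDiffAt ℝ ∞ (fun x => mkProd (f x) (g x)) x :=
  ((WithLp.prodContinuousLinearEquiv 2 ℝ (Euc n) (Euc k)).symm.contDiff).contDiffAt.comp x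
    (hf.prodMk hg)

theorem contDiff_eucProd_fst : ContDiff ℝ ∞ fun z : EucProd n k => z.fst :=
  (WithLp.fstL 2 ℝ (Euc n) (Euc k)).contDiff

theorem contDiff_eucProd_snd : ContDiff ℝ ∞ fun z : EucProd n k => z.snd :=
  (WithLp.sndL 2 ℝ (Euc n) (Euc k)).contDiff

/-- The field `z ↦ (t ↦ ∑ i, t i • u i z)` of linear maps. -/
noncomputable def sumField {E : Type*} [NormedAddCommGroup E] [NormedSpace ℝ E]
    (u : Fin k → E → E) (z : E) : Euc k →L[ℝ] E :=
  ∑ i, (EuclideanSpace.proj i : Euc k →L[ℝ] ℝ).smulRight (u i z)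

theorem sumField_apply {E : Type*} [NormedAddCommGroup E] [NormedSpace ℝ E]
    (u : Fin k → E → E) (z : E) (t : Euc k) : sumField u z t = ∑ i, t i • u i z := by
  simp [sumField]

theorem lipschitzOnWith_sumField {E : Type*} [NormedAddCommGroup E] [NormedSpace ℝ E]
    {u : Fin k → E → E} {L : Fin k → ℝ≥0} {U : Set E} (hu : ∀ i, LipschitzOnWith (L i) (u i) U) :
    LipschitzOnWith (∑ i, ‖(EuclideanSpace.proj i : Euc k →L[ℝ] ℝ)‖₊ * L i) (sumField u) U := by
  refine LipschitzOnWith.of_dist_le_mul fun x hx y hy => ?_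
  rw [dist_eq_norm, dist_eq_norm, sumField, sumField, ← Finset.sum_sub_distrib]
  push_cast
  rw [Finset.sum_mul]
  refine norm_sum_le_of_le _ fun i _ => ?_
  have e : (EuclideanSpace.proj i : Euc k →L[ℝ] ℝ).smulRight (u i x) -
      (EuclideanSpace.proj i : Euc k →L[ℝ] ℝ).smulRight (u i y) =
      (EuclideanSpace.proj i : Euc k →L[ℝ] ℝ).smulRight (u i x - u i y) := by
    ext t; simp [smul_sub]
  rw [e, ContinuousLinearMap.norm_smulRight_apply, mul_assoc]
  gcongr
  exact (hu i).norm_sub_le hx hy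

theorem exists_lipschitzOnWith_sumField {E : Type*} [NormedAddCommGroup E] [InnerProductSpace ℝ E]
    [FiniteDimensional ℝ E] {S : Stratification E} {u : Fin k → E → E}
    (hu : ∀ i, IsStratifiedLipschitzFieldGerm S (u i) 0) :
    ∃ K : ℝ≥0, ∃ U ∈ 𝓝 (0 : E), LipschitzOnWith K (sumField u) U := by
  choose U hU h0 hL _ using hu
  choose L hL using hL
  exact ⟨_, ⋂ i, U i, iInter_mem.2 fun i => (hU i).mem_nhds (h0 i),
    lipschitzOnWith_sumField fun i => (hL i).mono (iInter_subset U i)⟩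

theorem sumField_addPartial_snd (η : Fin k → EucProd n k → Euc n) (z : EucProd n k) (t : Euc k) :
    (sumField (fun i => addPartial (η i) i) z t).snd = t := by
  have : (WithLp.sndL 2 ℝ (Euc n) (Euc k)) (sumField (fun i => addPartial (η i) i) z t) = t := by
    rw [sumField_apply, map_sum]
    ext j
    simp [addPartial, Finset.sum_apply, Pi.single_apply]
  exact this

/-- This extracts the input of `exists_holonomy`: the `k` fields are bundled into one field of
linear maps. The identity `(w 0 t).snd = t` expresses the summand `∂/∂λᵢ` and makes the slice of
parameter `0` transverse. -/
theorem LipschitzTrivial.exists_fields {Φ : EucProd n k → Euc p} (h : LipschitzTrivial Φ)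
    (hΦ : ∀ᶠ z in 𝓝 0, ContDiffAt ℝ ∞ Φ z) (h0 : Φ 0 = 0) :
    ∃ (v : EucProd n k → Euc k →L[ℝ] EucProd n k) (w : EucProd p k → Euc k →L[ℝ] EucProd p k)
      (K L : ℝ≥0), ∃ U ∈ 𝓝 0, ∃ V ∈ 𝓝 0, LipschitzOnWith K v U ∧ LipschitzOnWith L w V ∧
      (∀ t, (w 0 t).snd = t) ∧ IsLipschitzGerm (withParam Φ) ∧
      (∀ᶠ z in 𝓝 0, DifferentiableAt ℝ (withParam Φ) z) ∧
      ∀ᶠ z in 𝓝 0, ∀ t, fderiv ℝ (withParam Φ) z (v z t) = w (withParam Φ z) t := by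
  obtain ⟨S, T, -, -, -, -, -, ξ, η, hξη⟩ := h
  obtain ⟨K, U, hU, hK⟩ := exists_lipschitzOnWith_sumField fun i => (hξη i).1
  obtain ⟨L, V, hV, hL⟩ := exists_lipschitzOnWith_sumField fun i => (hξη i).2.1
  have hs : ∀ᶠ z in 𝓝 0, ContDiffAt ℝ ∞ (withParam Φ) z :=
    hΦ.mono fun z hz => hz.mkProd contDiff_eucProd_snd.contDiffAt
  refine ⟨_, _, K, L, U, hU, V, hV, hK, hL, sumField_addPartial_snd η 0,
    hs.self_of_nhds.isLipschitzGerm ?_, hs.mono fun z hz => hz.differentiableAt (by simp), ?_⟩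
  · simp only [withParam, h0]
    rfl
  · filter_upwards [eventually_all.2 fun i => (hξη i).2.2] with z hz t
    simp only [sumField_apply, map_sum, map_smul, hz]

theorem mkProd_fst (x : Euc n) (l : Euc k) : (mkProd x l).fst = x := rfl

theorem mkProd_snd (x : Euc n) (l : Euc k) : (mkProd x l).snd = l := rfl

theorem mkProd_fst_snd (z : EucProd n k) : mkProd z.fst z.snd = z := rfl

theorem mkProd_fst_zero {y : EucProd n k} (hy : y.snd = 0) : mkProd y.fst 0 = y :=
  congrArg (mkProd y.fst) hy.symm

/-- Cancellation along the chain of slices `snd = 0`, `C`, `C'`, `snd = 0` traversed by `h`, `a`,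
`q`. The slides `h` and `q` are undone only on their starting slices, so the slice of each
intermediate point has to be tracked. -/
theorem eventually_conjugate_left_inverse {h h' : EucProd n p → EucProd n p}
    {q q' a a' : EucProd n p → EucProd n p} {C C' : EucProd n p → Prop}
    (hh : IsLipschitzGerm h) (ha : IsLipschitzGerm a) (hC : ∀ᶠ y in 𝓝 0, C (h y)) (hCC : ∀ᶠ y in 𝓝 0, C y → C' (a y))
    (haa : ∀ᶠ y in 𝓝 0, a' (a y) = y) (hhh : ∀ᶠ y in 𝓝 0, y.snd = 0 → h' (h y) = y)
    (hqq : ∀ᶠ y in 𝓝 0, C' y → q' (q y) = y) (hq0 : ∀ᶠ y in 𝓝 0, (q y).snd = 0) :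
    ∀ᶠ x : Euc n in 𝓝 0,
      (h' (a' (q' (mkProd (q (a (h (mkProd x 0)))).fst 0)))).fst = x := by
  have h0 : IsLipschitzGerm fun x : Euc n => (mkProd x 0 : EucProd n p) :=
    IsLipschitzGerm.id.mkProd (0 : Euc n →L[ℝ] Euc p).isLipschitzGerm
  have h1 := hh.comp h0
  have h2 := ha.comp h1
  filter_upwards [h0.tendsto.eventually hC, h1.tendsto.eventually hCC, h1.tendsto.eventually haa,
    h0.tendsto.eventually hhh, h2.tendsto.eventually hqq, h2.tendsto.eventually hq0]
    with x e1 e2 e3 e4 e5 e6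
  rw [mkProd_fst_zero e6, e5 (e2 e1), e3, e4 rfl]
  rfl

end

/-! ### Comparison of the two unfoldings -/

section

variable {n p : ℕ}

/-- Two unfoldings that are conjugate by smooth germs `b` and `(y, μ) ↦ (y, μ + y)`, and both of
which are Lipschitz trivial along their parameters, unfold bi-Lipschitz equivalent germs. -/
theorem biLipschitzAEquivalent_of_shear {f g : Euc n → Euc p} {Ψ Φ : EucProd n p → Euc p}
    (hf : IsLipschitzGerm f)
    (hΨf : ∀ᶠ x in 𝓝 (0 : Euc n), Ψ (mkProd x 0) = f x)
    (hΦg : ∀ᶠ x in 𝓝 (0 : Euc n), Φ (mkProd x 0) = g x)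
    (hΨ : ∀ᶠ z in 𝓝 0, ContDiffAt ℝ ∞ Ψ z) (hΦ : ∀ᶠ z in 𝓝 0, ContDiffAt ℝ ∞ Φ z)
    (hΨ0 : Ψ 0 = 0) (hΦ0 : Φ 0 = 0) (hΨt : LipschitzTrivial Ψ) (hΦt : LipschitzTrivial Φ)
    {b b' : EucProd n p → EucProd n p} (hb : IsLipschitzGerm b) (hb' : IsLipschitzGerm b')
    (hbb' : ∀ᶠ z in 𝓝 0, b' (b z) = z) (hb'b : ∀ᶠ z in 𝓝 0, b (b' z) = z)
    (hconj : ∀ᶠ z in 𝓝 0, withParam Φ (b z) = mkProd (Ψ z) (z.snd + Ψ z)) :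
    BiLipschitzAEquivalent f g := by
  obtain ⟨v, w, K, L, U, hU, V, hV, hv, hw, hws, hGl, hGd, hG⟩ := hΨt.exists_fields hΨ hΨ0
  obtain ⟨v', w', K', L', U', hU', V', hV', hv', hw', hws', hGl', hGd', hG'⟩ :=
    hΦt.exists_fields hΦ hΦ0
  obtain ⟨h, H, hH⟩ := exists_holonomy hU hv hV hw hGl hGd hG
  obtain ⟨h', H', hH'⟩ := exists_holonomy hU' hv' hV' hw' hGl' hGd' hG'
  let π₁ : EucProd p p →L[ℝ] Euc p := WithLp.fstL 2 ℝ (Euc p) (Euc p)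
  let π₂ : EucProd p p →L[ℝ] Euc p := WithLp.sndL 2 ℝ (Euc p) (Euc p)
  -- Under the shear, `π₂` pulls back to `π₂ + π₁`, and `π₂ - π₁` pulls back to `π₂`. Hence `ρ` is
  -- the pullback of `ρ'` for every `c`, and `c` is free to secure both transversalities.
  obtain ⟨c, hc, hc'⟩ := exists_isInvertible_add_smul ((π₂ + π₁) ∘L w 0) ((π₂ - π₁) ∘L w' 0)
  let ρ := π₂ + c • (π₂ + π₁)
  let ρ' := (π₂ - π₁) + c • π₂
  have hρ : (ρ ∘L w 0).IsInvertible := by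
    have e : ρ ∘L w 0 = ContinuousLinearMap.id ℝ (Euc p) + c • ((π₂ + π₁) ∘L w 0) := by
      ext1 t
      have : π₂ (w 0 t) = t := hws t
      simp [ρ, this]
    rw [e]
    exact hc
  have hρ' : (ρ' ∘L w' 0).IsInvertible := by
    have e : ρ' ∘L w' 0 = (π₂ - π₁) ∘L w' 0 + c • ContinuousLinearMap.id ℝ (Euc p) := by
      ext1 t
      have : π₂ (w' 0 t) = t := hws' t
      simp [ρ', this]
    rw [e]
    exact hc'
  have hπ : (π₂ ∘L w 0).IsInvertible := by
    have : π₂ ∘L w 0 = ContinuousLinearMap.id ℝ (Euc p) := ContinuousLinearMap.ext hws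
    rw [this]
    exact ⟨ContinuousLinearEquiv.refl ℝ _, rfl⟩
  have hπ' : (π₂ ∘L w' 0).IsInvertible := by
    have : π₂ ∘L w' 0 = ContinuousLinearMap.id ℝ (Euc p) := ContinuousLinearMap.ext hws'
    rw [this]
    exact ⟨ContinuousLinearEquiv.refl ℝ _, rfl⟩
  let α : EucProd p p → EucProd p p := fun y => mkProd y.fst (y.snd + y.fst)
  let α' : EucProd p p → EucProd p p := fun y => mkProd y.fst (y.snd - y.fst)
  have hα : IsLipschitzGerm α :=
    π₁.isLipschitzGerm.mkProd (π₂ + π₁).isLipschitzGerm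
  have hα' : IsLipschitzGerm α' :=
    π₁.isLipschitzGerm.mkProd (π₂ - π₁).isLipschitzGerm
  have hαα' : ∀ y, α' (α y) = y := fun y => by
    change mkProd y.fst (y.snd + y.fst - y.fst) = y
    rw [add_sub_cancel_right, mkProd_fst_snd]
  have hα'α : ∀ y, α (α' y) = y := fun y => by
    change mkProd y.fst (y.snd - y.fst + y.fst) = y
    rw [sub_add_cancel, mkProd_fst_snd]
  have hρα : ∀ y, ρ' (α y) = ρ y := fun y => by
    change (y.snd + y.fst - y.fst) + c • (y.snd + y.fst) = y.snd + c • (y.snd + y.fst)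
    rw [add_sub_cancel_right]
  have hρα' : ∀ y, ρ (α' y) = ρ' y := fun y => by
    rw [← hρα, hα'α]
  have hbG : ∀ᶠ z in 𝓝 0, withParam Φ (b z) = α (withParam Ψ z) := hconj
  have hbG' : ∀ᶠ z in 𝓝 0, withParam Ψ (b' z) = α' (withParam Φ z) := by
    filter_upwards [hb'.tendsto.eventually hbG, hb'b] with z h1 h2
    rw [h2] at h1
    rw [h1, hαα']
  obtain ⟨hl, Hl, h0, hGH, hinv⟩ := hH ρ hρ
  obtain ⟨hlπ, Hlπ, h0π, hGHπ, hinvπ⟩ := hH π₂ hπ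
  obtain ⟨hl', Hl', h0', hGH', hinv'⟩ := hH' ρ' hρ'
  obtain ⟨hlπ', Hlπ', h0π', hGHπ', hinvπ'⟩ := hH' π₂ hπ'
  have hH0 : ∀ᶠ x in 𝓝 0, ρ (withParam Ψ (H ρ x)) = 0 := by
    filter_upwards [hGH, hGl.tendsto.eventually h0] with x h1 h2
    rw [h1, h2]
  have hH0π : ∀ᶠ x in 𝓝 0, (H π₂ x).snd = 0 := by
    filter_upwards [hGHπ, hGl.tendsto.eventually h0π] with x h1 h2
    rw [← h1] at h2
    exact h2
  have hH0' : ∀ᶠ x in 𝓝 0, ρ' (withParam Φ (H' ρ' x)) = 0 := by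
    filter_upwards [hGH', hGl'.tendsto.eventually h0'] with x h1 h2
    rw [h1, h2]
  have hH0π' : ∀ᶠ x in 𝓝 0, (H' π₂ x).snd = 0 := by
    filter_upwards [hGHπ', hGl'.tendsto.eventually h0π'] with x h1 h2
    rw [← h1] at h2
    exact h2
  have hι : ∀ {m : ℕ}, IsLipschitzGerm fun x : Euc m => (mkProd x 0 : EucProd m p) :=
    IsLipschitzGerm.id.mkProd (0 : Euc _ →L[ℝ] Euc p).isLipschitzGerm
  have hσ : IsLipschitzGerm fun x : Euc n => (H' π₂ (b (H ρ (mkProd x 0)))).fst :=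
    (Hlπ'.comp (hb.comp (Hl.comp hι))).fst
  have hσ' : IsLipschitzGerm fun x : Euc n => (H π₂ (b' (H' ρ' (mkProd x 0)))).fst :=
    (Hlπ.comp (hb'.comp (Hl'.comp hι))).fst
  have hτ' : IsLipschitzGerm fun y : Euc p => (h' π₂ (α (h ρ (mkProd y 0)))).fst :=
    (hlπ'.comp (hα.comp (hl.comp hι))).fst
  have hτ : IsLipschitzGerm fun y : Euc p => (h π₂ (α' (h' ρ' (mkProd y 0)))).fst :=
    (hlπ.comp (hα'.comp (hl'.comp hι))).fst
  have hσσ : ∀ᶠ x : Euc n in 𝓝 0, (H π₂ (b' (H' ρ' (mkProd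
      (H' π₂ (b (H ρ (mkProd x 0)))).fst 0)))).fst = x :=
    eventually_conjugate_left_inverse (C := fun x => ρ (withParam Ψ x) = 0)
      (C' := fun x => ρ' (withParam Φ x) = 0) Hl hb hH0
      (hbG.mono fun x hx h => by rw [hx, hρα, h]) hbb' (hinv π₂ hπ).2 (hinvπ' ρ' hρ').2 hH0π'
  have hσσ' : ∀ᶠ x : Euc n in 𝓝 0, (H' π₂ (b (H ρ (mkProd
      (H π₂ (b' (H' ρ' (mkProd x 0)))).fst 0)))).fst = x :=
    eventually_conjugate_left_inverse (C := fun x => ρ' (withParam Φ x) = 0)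
      (C' := fun x => ρ (withParam Ψ x) = 0) Hl' hb' hH0'
      (hbG'.mono fun x hx h => by rw [hx, hρα', h]) hb'b (hinv' π₂ hπ').2 (hinvπ ρ hρ).2 hH0π
  have hττ : ∀ᶠ y : Euc p in 𝓝 0, (h π₂ (α' (h' ρ' (mkProd
      (h' π₂ (α (h ρ (mkProd y 0)))).fst 0)))).fst = y :=
    eventually_conjugate_left_inverse (C := fun y => ρ y = 0)
      (C' := fun y => ρ' y = 0) hl hα h0 (.of_forall fun y hy => by rw [hρα, hy])
      (.of_forall hαα') (hinv π₂ hπ).1 (hinvπ' ρ' hρ').1 h0π'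
  have hττ' : ∀ᶠ y : Euc p in 𝓝 0, (h' π₂ (α (h ρ (mkProd
      (h π₂ (α' (h' ρ' (mkProd y 0)))).fst 0)))).fst = y :=
    eventually_conjugate_left_inverse (C := fun y => ρ' y = 0)
      (C' := fun y => ρ y = 0) hl' hα' h0' (.of_forall fun y hy => by rw [hρα', hy])
      (.of_forall hα'α) (hinv' π₂ hπ').1 (hinvπ ρ hρ).1 h0π
  -- The target germ runs from the slice of `g` back to that of `f`, opposite to the source germ. It
  -- remains to see that its inverse carries `f` to `g ∘ σ`.
  refine ⟨_, _, hσ.isBiLipschitzGerm hσ' hσσ hσσ', hτ.isBiLipschitzGerm hτ' hττ' hττ, ?_⟩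
  filter_upwards [hΨf, hσ.tendsto.eventually hΦg, hι.tendsto.eventually hGH,
    (Hl.comp hι).tendsto.eventually hbG, (hb.comp (Hl.comp hι)).tendsto.eventually hGHπ',
    (hb.comp (Hl.comp hι)).tendsto.eventually hH0π', hf.tendsto.eventually hττ]
    with x e1 e2 e3 e4 e5 e6 e7
  have eg : g (H' π₂ (b (H ρ (mkProd x 0)))).fst = (h' π₂ (α (h ρ (mkProd (f x) 0)))).fst := by
    rw [← e2, mkProd_fst_zero e6, ← e1]
    change (withParam Φ (H' π₂ (b (H ρ (mkProd x 0))))).fst = _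
    rw [e5, e4, e3]
    rfl
  rw [eg, e7]

theorem biLipschitzAEquivalent_of_contact {f g : Euc n → Euc p}
    (hf : ∀ᶠ x in 𝓝 0, ContDiffAt ℝ ∞ f x) (hf0 : f 0 = 0)
    (hg : ∀ᶠ x in 𝓝 0, ContDiffAt ℝ ∞ g x) (hg0 : g 0 = 0)
    (hfs : LipschitzStable f) (hgs : LipschitzStable g) {s s' : Euc n → Euc n}
    (hs : ∀ᶠ x in 𝓝 0, ContDiffAt ℝ ∞ s x) (hs' : ∀ᶠ x in 𝓝 0, ContDiffAt ℝ ∞ s' x)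
    (hs0 : s 0 = 0) (hs0' : s' 0 = 0) (hss : ∀ᶠ x in 𝓝 0, s' (s x) = x)
    (hss' : ∀ᶠ x in 𝓝 0, s (s' x) = x) {M : Euc n → (Euc p →L[ℝ] Euc p)ˣ}
    (hM : ∀ᶠ x in 𝓝 0, ContDiffAt ℝ ∞ (fun x => (M x : Euc p →L[ℝ] Euc p)) x)
    (hfg : ∀ᶠ x in 𝓝 0, f x = (M x : Euc p →L[ℝ] Euc p) (g (s x))) :
    BiLipschitzAEquivalent f g := by
  have hMi : ∀ᶠ x in 𝓝 0, ContDiffAt ℝ ∞ (fun x => (↑(M x)⁻¹ : Euc p →L[ℝ] Euc p)) x := by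
    filter_upwards [hM] with x hx
    have := (contDiffAt_ringInverse ℝ (n := ∞) (M x)).comp x hx
    simpa [Function.comp_def] using this
  have tf : Tendsto (fun z : EucProd n p => z.fst) (𝓝 0) (𝓝 0) :=
    contDiff_eucProd_fst.continuous.tendsto 0
  have ts : Tendsto s (𝓝 0) (𝓝 0) := by
    simpa [hs0] using hs.self_of_nhds.continuousAt.tendsto
  have ts' : Tendsto s' (𝓝 0) (𝓝 0) := by
    simpa [hs0'] using hs'.self_of_nhds.continuousAt.tendsto
  have cf : ∀ z, ContDiffAt ℝ ∞ (fun z : EucProd n p => z.fst) z :=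
    fun z => contDiff_eucProd_fst.contDiffAt
  have cs : ∀ z, ContDiffAt ℝ ∞ (fun z : EucProd n p => z.snd) z :=
    fun z => contDiff_eucProd_snd.contDiffAt
  -- Adding the parameter to either unfolding gives a simple map: `Ψ + μ = f + Mμ = M(μ + g ∘ s)`,
  -- which is the parameter component of `b`.
  let Ψ : EucProd n p → Euc p := fun z =>
    f z.fst + (M z.fst : Euc p →L[ℝ] Euc p) z.snd - z.snd
  let Φ : EucProd n p → Euc p := fun z =>
    g z.fst + z.snd - (↑(M (s' z.fst))⁻¹ : Euc p →L[ℝ] Euc p) z.snd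
  let b : EucProd n p → EucProd n p := fun z =>
    mkProd (s z.fst) ((M z.fst : Euc p →L[ℝ] Euc p) (z.snd + g (s z.fst)))
  let b' : EucProd n p → EucProd n p := fun z =>
    mkProd (s' z.fst) ((↑(M (s' z.fst))⁻¹ : Euc p →L[ℝ] Euc p) z.snd - g z.fst)
  have hz1 : (0 : EucProd n p).fst = 0 := rfl
  have hΨ : ∀ᶠ z in 𝓝 0, ContDiffAt ℝ ∞ Ψ z := by
    filter_upwards [tf.eventually hf, tf.eventually hM] with z h1 h2
    exact ((h1.comp z (cf z)).add ((h2.comp z (cf z)).clm_apply (cs z))).sub (cs z)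
  have hΦ : ∀ᶠ z in 𝓝 0, ContDiffAt ℝ ∞ Φ z := by
    filter_upwards [tf.eventually hg, tf.eventually (ts'.eventually hMi), tf.eventually hs']
      with z h1 h2 h3
    have h4 : ContDiffAt ℝ ∞
        (fun z : EucProd n p => (↑(M (s' z.fst))⁻¹ : Euc p →L[ℝ] Euc p)) z :=
      ContDiffAt.comp (g := fun x => (↑(M x)⁻¹ : Euc p →L[ℝ] Euc p))
        (f := fun z : EucProd n p => s' z.fst) z h2 (h3.comp z (cf z))
    exact ((h1.comp z (cf z)).add (cs z)).sub (h4.clm_apply (cs z))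
  have hΨ0 : Ψ 0 = 0 := by simp [Ψ, hf0]
  have hΦ0 : Φ 0 = 0 := by simp [Φ, hg0]
  have hΨf : ∀ x, Ψ (mkProd x 0) = f x := fun x => by simp [Ψ]
  have hΦg : ∀ x, Φ (mkProd x 0) = g x := fun x => by simp [Φ]
  have hb : IsLipschitzGerm b := by
    refine ContDiffAt.isLipschitzGerm ?_ (by simp [b, hs0, hg0])
    have h1 := hs.self_of_nhds.comp (0 : EucProd n p) (cf 0)
    have h2 : ContDiffAt ℝ ∞ g (s (0 : EucProd n p).fst) := by
      rw [hz1, hs0]; exact hg.self_of_nhds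
    have h3 : ContDiffAt ℝ ∞ (fun z : EucProd n p => g (s z.fst)) 0 :=
      ContDiffAt.comp (g := g) (f := fun z : EucProd n p => s z.fst) 0 h2 h1
    have h4 : ContDiffAt ℝ ∞ (fun z : EucProd n p => (M z.fst : Euc p →L[ℝ] Euc p)) 0 :=
      ContDiffAt.comp (g := fun x => (M x : Euc p →L[ℝ] Euc p))
        (f := fun z : EucProd n p => z.fst) 0 hM.self_of_nhds (cf 0)
    exact h1.mkProd (h4.clm_apply ((cs 0).add h3))
  have hb' : IsLipschitzGerm b' := by
    refine ContDiffAt.isLipschitzGerm ?_ (by simp [b', hs0', hg0])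
    have h1 := hs'.self_of_nhds.comp (0 : EucProd n p) (cf 0)
    have h2 : ContDiffAt ℝ ∞ (fun x => (↑(M x)⁻¹ : Euc p →L[ℝ] Euc p))
        (s' (0 : EucProd n p).fst) := by
      rw [hz1, hs0']; exact hMi.self_of_nhds
    have h3 : ContDiffAt ℝ ∞
        (fun z : EucProd n p => (↑(M (s' z.fst))⁻¹ : Euc p →L[ℝ] Euc p)) 0 :=
      ContDiffAt.comp (g := fun x => (↑(M x)⁻¹ : Euc p →L[ℝ] Euc p))
        (f := fun z : EucProd n p => s' z.fst) 0 h2 h1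
    exact h1.mkProd ((h3.clm_apply (cs 0)).sub
      (hg.self_of_nhds.comp (0 : EucProd n p) (cf 0)))
  have inv1 : ∀ (A : (Euc p →L[ℝ] Euc p)ˣ) (y : Euc p),
      (↑A⁻¹ : Euc p →L[ℝ] Euc p) ((A : Euc p →L[ℝ] Euc p) y) = y := fun A y => by
    rw [← mul_apply_eq_comp, A.inv_mul]; rfl
  have inv2 : ∀ (A : (Euc p →L[ℝ] Euc p)ˣ) (y : Euc p),
      (A : Euc p →L[ℝ] Euc p) ((↑A⁻¹ : Euc p →L[ℝ] Euc p) y) = y := fun A y => by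
    rw [← mul_apply_eq_comp, A.mul_inv]; rfl
  refine biLipschitzAEquivalent_of_shear (hf.self_of_nhds.isLipschitzGerm hf0)
    (.of_forall hΨf) (.of_forall hΦg) hΨ hΦ hΨ0 hΦ0
    (hfs p Ψ ⟨isSmoothGerm_iff_eventually_contDiffAt.2 hΨ, hΨ0, .of_forall hΨf⟩)
    (hgs p Φ ⟨isSmoothGerm_iff_eventually_contDiffAt.2 hΦ, hΦ0, .of_forall hΦg⟩)
    hb hb' ?_ ?_ ?_
  · filter_upwards [tf.eventually hss] with z hz
    simp only [b, b', mkProd_fst, mkProd_snd, hz, inv1, add_sub_cancel_right, mkProd_fst_snd]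
  · filter_upwards [tf.eventually hss'] with z hz
    simp only [b, b', mkProd_fst, mkProd_snd, hz, inv2, sub_add_cancel, mkProd_fst_snd]
  -- In `Φ ∘ b` the inverse matrix, taken at `s'(s(x)) = x`, cancels `M(x)` and leaves `g(s(x)) +
  -- M(x)(μ + g(s(x))) - (μ + g(s(x)))`, which is `Ψ` since `f = M · (g ∘ s)`.
  · filter_upwards [tf.eventually hss, tf.eventually hfg] with z hz hz'
    simp only [b, withParam, Φ, Ψ, mkProd_fst, mkProd_snd, hz, hz', inv1, map_add]
    congr 1 <;> abel

/-- A matrix function with smooth entries, as a smooth function with values in the linear maps. -/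
theorem contDiffAt_toEuclideanCLM {E : Type*} [NormedAddCommGroup E] [NormedSpace ℝ E]
    {M : E → Matrix (Fin p) (Fin p) ℝ} {x : E} (hM : ∀ i j, ContDiffAt ℝ ∞ (fun x => M x i j) x) :
    ContDiffAt ℝ ∞ (fun x => Matrix.toEuclideanCLM (n := Fin p) (𝕜 := ℝ) (M x)) x := by
  have e : (fun x => Matrix.toEuclideanCLM (n := Fin p) (𝕜 := ℝ) (M x)) = fun x =>
      ∑ i, ∑ j, M x i j • Matrix.toEuclideanCLM (n := Fin p) (𝕜 := ℝ) (Matrix.single i j 1) := by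
    ext1 x
    conv_lhs => rw [Matrix.matrix_eq_sum_single (M x)]
    simp only [map_sum]
    refine Finset.sum_congr rfl fun i _ => Finset.sum_congr rfl fun j _ => ?_
    rw [← map_smul, Matrix.smul_single, smul_eq_mul, mul_one]
  rw [e]
  exact ContDiffAt.sum fun i _ => ContDiffAt.sum fun j _ => (hM i j).smul contDiffAt_const

end

theorem corollary1 (n p : ℕ) (f g : Euc n → Euc p)
    (hf : IsSmoothGerm f 0) (hf0 : f 0 = 0) (hg : IsSmoothGerm g 0) (hg0 : g 0 = 0)
    (hfs : LipschitzStable f) (hgs : LipschitzStable g)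
    (s : Euc n → Euc n) (hs : IsSmoothDiffeoGerm s)
    (M : Euc n → Matrix.GeneralLinearGroup (Fin p) ℝ)
    (hM : ∀ i j, IsSmoothGerm (fun x => (M x : Matrix (Fin p) (Fin p) ℝ) i j) 0)
    (hfg : ∀ᶠ x in 𝓝 (0 : Euc n),
      (f x).ofLp = (M x : Matrix (Fin p) (Fin p) ℝ).mulVec (g (s x)).ofLp) :
    BiLipschitzAEquivalent f g := by
  simp only [isSmoothGerm_iff_eventually_contDiffAt] at hf hg hM
  obtain ⟨hs0, φ, h0, hsφ, hφ, hφ'⟩ := hs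
  have hn : φ.source ∈ 𝓝 0 := φ.open_source.mem_nhds h0
  have h0' : (0 : Euc n) ∈ φ.target := by
    rw [← hs0, hsφ h0]; exact φ.map_source h0
  have hn' : φ.target ∈ 𝓝 0 := φ.open_target.mem_nhds h0'
  have hi0 : φ.symm 0 = 0 := by
    conv_lhs => rw [← hs0, hsφ h0]
    exact φ.left_inv h0
  refine biLipschitzAEquivalent_of_contact hf hf0 hg hg0 hfs hgs (s := s) (s' := φ.symm)
    (M := fun x => Units.map (Matrix.toEuclideanCLM (n := Fin p) (𝕜 := ℝ) :
      Matrix (Fin p) (Fin p) ℝ →* (Euc p →L[ℝ] Euc p)) (M x)) ?_ ?_ hs0 hi0 ?_ ?_ ?_ ?_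
  · filter_upwards [hn] with x hx
    exact ((hφ.congr hsφ).contDiffAt (φ.open_source.mem_nhds hx))
  · filter_upwards [hn'] with x hx
    exact hφ'.contDiffAt (φ.open_target.mem_nhds hx)
  · filter_upwards [hn] with x hx
    rw [hsφ hx, φ.left_inv hx]
  · filter_upwards [hn'] with x hx
    rw [hsφ (φ.map_target hx), φ.right_inv hx]
  · filter_upwards [eventually_all.2 fun i => eventually_all.2 fun j => hM i j] with x hx
    exact contDiffAt_toEuclideanCLM hx
  · filter_upwards [hfg] with x hx
    apply WithLp.ofLp_injective
    rw [hx]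
    exact (Matrix.ofLp_toEuclideanCLM _ _).symm
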